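/- Let $d\ge 0$ and consider on $\mathbb{R}^d$ the control problem with dynamics $\dot{\mathbf x}=\mathbf u$ and Lagrangian $L(x,u)=-|x|^2-|u|^2$, where $|\cdot|$ is the Euclidean norm. For $\lambda\in\mathbb{R}$ and $T\ge 0$ let $$A^T_\lambda(x,y)=-\lambda T+\sup\int_0^T L(\mathbf x(s),\mathbf u(s))\,ds\in\mathbb{R}\cup\{\pm\infty\},$$ the supremum being over all measurable $\mathbf u$ and absolutely continuous $\mathbf x$ on $[0,T]$ with $\dot{\mathbf x}=\mathbf u$ almost everywhere, $\mathbf x(0)=x$ and $\mathbf x(T)=y$ (so it is $-\infty$ if there is no such pair). Let $A^*_\lambda(x,y)=\sup_{T\ge 0}A^T_\lambda(x,y)$. When $A^*_\lambda$ is finite, the Martin kernel with basepoint $0$ is $K_\lambda(x,y)=A^*_\lambda(x,y)-A^*_\lambda(0,y)$, and the Martin boundary $\mathscr B_\lambda$ is the closure of $\mathscr K_\lambda=\{K_\lambda(\cdot,y): y\in\mathbb{R}^d\}$ in $\mathbb{R}^{\mathbb{R}^d}$, for the topology of pointwise convergence, minus $\mathscr K_\lambda$ itself. Then: (1) For all $\lambda\in\mathbb{R}$,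 $T>0$ and $x,y\in\mathbb{R}^d$, $$A^T_\lambda(x,y)=-\frac{(|x|^2+|y|^2)\cosh T-2\,x\cdot y}{\sinh T}-\lambda T.$$ (2) For all $\lambda\ge 0$, $A^*_\lambda(x,y)$ is finite for all $x,y\in\mathbb{R}^d$. (3) If $\lambda=0$, then $A^*_0(x,y)=-|x|^2-|y|^2$ if $x\cdot y\le 0$, and $A^*_0(x,y)=-|x-y|\,|x+y|$ if $x\cdot y>0$. For every unit vector $n$ and every $x$, the limit $\lim_{r\to+\infty}K_0(x,rn)$ exists and equals $$h_n(x)=\begin{cases}-|x|^2+2(x\cdot n)^2,& x\cdot n>0,\\ -|x|^2,&\text{otherwise,}\end{cases}$$ and $\mathscr B_0=\{h_n:\ |n|=1\}$. (4) If $\lambda>0$, then for all $y$, $$A^*_\lambda(0,y)=-|y|\sqrt{\lambda+|y|^2}-\lambda\log\bigl(\sqrt{\lambda+|y|^2}+|y|\bigr)+\lambda\log\sqrt\lambda .$$ For every unit vector $n$ and every $x$, the limit $\lim_{r\to+\infty}K_\lambda(x,rn)$ exists and equals $$h_n(x)=-\lambda\frac{|x|^2}{R^2}+x\cdot n\,\frac{\lambda+2|x|^2}{R}-\lambda\log\frac{R}{\sqrt\lambda},\qquad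 R=\sqrt{(x\cdot n)^2+\lambda}-x\cdot n,$$ and $\mathscr B_\lambda=\{h_n:\ |n|=1\}$. -/

import Mathlib

open MeasureTheory Filter Topology
open scoped ENNReal

noncomputable section

namespace LQMartin

/-- Admissible trajectories on `[0, T]` of the control system `ξ' = f (ξ, u)` going from `x` to `y`:
the control `u` is measurable and the state `ξ` is absolutely continuous. -/
structure IsTrajectory {E : Type*} [NormedAddCommGroup E] [NormedSpace ℝ E] [MeasurableSpace E]
    (f : E → E → E) (T : ℝ) (x y : E) (ξ u : ℝ → E) : Prop where
  measurable_control : Measurable u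
  absolutelyContinuous_state : AbsolutelyContinuousOnInterval ξ 0 T
  dynamics : ∀ᵐ s ∂(volume.restrict (Set.Icc 0 T)), HasDerivAt ξ (f (ξ s) (u s)) s
  initial : ξ 0 = x
  final : ξ T = y

/-- The reward `∫₀ᵀ L (ξ s, u s) ds`, as an extended real number: the integral of the positive part
minus the integral of the negative part (with the convention `⊤ - ⊤ = ⊥`). -/
def reward {E : Type*} (L : E → E → ℝ) (T : ℝ) (ξ u : ℝ → E) : EReal :=
  ((∫⁻ s in Set.Icc 0 T, ENNReal.ofReal (L (ξ s) (u s)) : ℝ≥0∞) : EReal)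
    - ((∫⁻ s in Set.Icc 0 T, ENNReal.ofReal (-L (ξ s) (u s)) : ℝ≥0∞) : EReal)

/-- The kernel `A^T (x, y)` of the Lax-Oleinik semigroup: the supremum of the reward over all
trajectories on `[0, T]` from `x` to `y` (and `⊥`, i.e. `-∞`, if there is none). -/
def laxOleinikKernel {E : Type*} [NormedAddCommGroup E] [NormedSpace ℝ E] [MeasurableSpace E]
    (f : E → E → E) (L : E → E → ℝ) (T : ℝ) (x y : E) : EReal :=
  ⨆ (ξ : ℝ → E) (u : ℝ → E) (_ : IsTrajectory f T x y ξ u), reward L T ξ u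

section Martin

variable {X : Type*}

/-- The kernel of the normalised semigroup `A_lam^T = -lam T + A^T`. -/
def normalisedKernel (A : ℝ → X → X → EReal) (lam : ℝ) (T : ℝ) (x y : X) : EReal :=
  ((-(lam * T) : ℝ) : EReal) + A T x y

/-- The kernel `A^* (x, y)` of `A^* = sup_{T ≥ 0} A^T`. -/
def starKernel (A : ℝ → X → X → EReal) (x y : X) : EReal :=
  ⨆ (T : ℝ) (_ : 0 ≤ T), A T x y

/-- The max-plus Martin kernel `K (x, y) = A^* (x, y) - A^* (b, y)` with basepoint `b`. -/
def martinKernel (A : ℝ → X → X → EReal) (b x y : X) : EReal :=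
  starKernel A x y - starKernel A b y

/-- The set of the functions `K (·, y)`, `y ∈ X`, as a subset of `ℝ^X`. -/
def martinPoints (A : ℝ → X → X → EReal) (b : X) : Set (X → ℝ) :=
  {g | ∃ y : X, ∀ x : X, (g x : EReal) = martinKernel A b x y}

/-- The max-plus Martin space: the closure in the topology of pointwise convergence. -/
def martinSpace (A : ℝ → X → X → EReal) (b : X) : Set (X → ℝ) :=
  closure (martinPoints A b)

/-- The max-plus Martin boundary. -/
def martinBoundary (A : ℝ → X → X → EReal) (b : X) : Set (X → ℝ) :=
  martinSpace A b \ martinPoints A b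

end Martin

/-- The Lagrangian `L (x, u) = -|x|² - |u|²` on `ℝ^d`. -/
def lqLagrangian (d : ℕ) (x u : EuclideanSpace ℝ (Fin d)) : ℝ :=
  -‖x‖ ^ 2 - ‖u‖ ^ 2

/-- The kernel `A_lam^T (x, y)` of the normalised Lax-Oleinik semigroup of the linear quadratic
problem on `ℝ^d`, with dynamics `ξ' = u` and Lagrangian `-|x|² - |u|²`. -/
def lqKernel (d : ℕ) (lam : ℝ) :
    ℝ → EuclideanSpace ℝ (Fin d) → EuclideanSpace ℝ (Fin d) → EReal :=
  normalisedKernel (laxOleinikKernel (fun _ u => u) (lqLagrangian d)) lam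

open Classical in
/-- The function `h_n` in the case `lam = 0`. -/
def horoZero {d : ℕ} (n x : EuclideanSpace ℝ (Fin d)) : ℝ :=
  if 0 < inner ℝ x n then -‖x‖ ^ 2 + 2 * (inner ℝ x n) ^ 2 else -‖x‖ ^ 2

/-- The quantity `R = √((x · n)² + lam) - x · n`. -/
def horoR {d : ℕ} (lam : ℝ) (n x : EuclideanSpace ℝ (Fin d)) : ℝ :=
  Real.sqrt ((inner ℝ x n) ^ 2 + lam) - inner ℝ x n

/-- The function `h_n` in the case `lam > 0`. -/
def horoPos {d : ℕ} (lam : ℝ) (n x : EuclideanSpace ℝ (Fin d)) : ℝ :=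
  -(lam * (‖x‖ ^ 2 / horoR lam n x ^ 2))
    + inner ℝ x n * ((lam + 2 * ‖x‖ ^ 2) / horoR lam n x)
    - lam * Real.log (horoR lam n x / Real.sqrt lam)

end LQMartin

end

/-!
# The Martin boundary of a linear quadratic control problem

*Fixed horizon.* Let `z` solve `z'' = z` with `z 0 = x`, `z T = y`. Along any trajectory `ξ' = u`
from `x` to `y`, the function `⟪z', 2 ξ - z⟫` has derivative
`|ξ|² + |u|² - |ξ - z|² - |u - z'|² ≤ |ξ|² + |u|²`, and its increment over `[0, T]` depends on `x`
and `y` only. Since it is absolutely continuous, the fundamental theorem of calculus bounds the cost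
of every trajectory from below, with equality for `ξ = z` (`laxOleinikKernel_lq`). No integrability
of `|u|²` is needed, as the costs are nonnegative and compared as Lebesgue integrals in `[0, ∞]`.

*Supremum over the horizon.* Write `a = |x|² + |y|²`, `b = x · y` and `D = √(b² + lam (a + lam))`.
For `lam > 0` the derivative of `-(a cosh T - 2 b) / sinh T - lam T` has the sign of `C - cosh T`
with `C = (D - b) / lam ≥ 1`, so the maximum is at `T = arcosh C` and equals
`-√((a + lam)² - (b + D)²) - lam * arcosh C` (`starKernel_lq`). For `lam = 0` the same formula holds
(with `D = |b|`, and no second term), although the supremum is only approached as `T → ∞` if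
`b ≤ 0`. The formula shows that `A^*` is continuous in `y`, including at `y = x`, where `T = 0`.

*Boundary.* Put `p = x · y / |y|`. When `|y| → ∞` and `y / |y| → n`, rationalising the square root
and using `arcosh C = log (C + √(C² - 1))` gives the limit of `A^* (x, y) - A^* (0, y)`
(`tendsto_martin_zero`, `tendsto_martin_pos`); it is a joint limit in `|y|` and `y / |y|`.
A limit point of the functions `K (·, y)` is a limit along an ultrafilter of points `y`, which
either stays in a ball, and then converges to some `y₀` and gives `K (·, y₀)`, or goes to infinity,
and then has a limit direction `n` and gives `h_n` (`closure_range_diff_range_eq`). Finally `h_n` is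
not one of the `K (·, y)`: the latter are bounded above because `A^* ≤ 0`, whereas
`h_n (t n) ≥ t²` for `t > 0`.
-/

noncomputable section

namespace LQMartin

/-! ### The kernel with a fixed horizon -/

section Extremal

variable {E : Type*} [NormedAddCommGroup E] [InnerProductSpace ℝ E]

/-- The least cost `∫₀ᵀ (|ξ|² + |ξ'|²)` of a trajectory from `x` to `y` in time `T > 0`. -/
def lqCost (T : ℝ) (x y : E) : ℝ :=
  ((‖x‖ ^ 2 + ‖y‖ ^ 2) * Real.cosh T - 2 * inner ℝ x y) / Real.sinh T

/-- The solution `z` of the Euler-Lagrange equation `z'' = z` with `z 0 = x` and `z T = y`. -/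
def extremal (T : ℝ) (x y : E) (s : ℝ) : E :=
  (Real.sinh (T - s) / Real.sinh T) • x + (Real.sinh s / Real.sinh T) • y

/-- The derivative of `extremal T x y`. -/
def extremalVelocity (T : ℝ) (x y : E) (s : ℝ) : E :=
  (-(Real.cosh (T - s) / Real.sinh T)) • x + (Real.cosh s / Real.sinh T) • y

lemma hasDerivAt_extremal (T : ℝ) (x y : E) (s : ℝ) :
    HasDerivAt (extremal T x y) (extremalVelocity T x y s) s := by
  have h1 : HasDerivAt (fun s : ℝ => Real.sinh (T - s) / Real.sinh T)
      (-(Real.cosh (T - s) / Real.sinh T)) s := by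
    have := ((Real.hasDerivAt_sinh (T - s)).comp s ((hasDerivAt_id s).const_sub T)).div_const
      (Real.sinh T)
    exact this.congr_deriv (by simp [neg_div])
  exact (h1.smul_const x).add (((Real.hasDerivAt_sinh s).div_const _).smul_const y)

lemma hasDerivAt_extremalVelocity (T : ℝ) (x y : E) (s : ℝ) :
    HasDerivAt (extremalVelocity T x y) (extremal T x y s) s := by
  have h1 : HasDerivAt (fun s : ℝ => -(Real.cosh (T - s) / Real.sinh T))
      (Real.sinh (T - s) / Real.sinh T) s := by
    have := (((Real.hasDerivAt_cosh (T - s)).comp s ((hasDerivAt_id s).const_sub T)).div_const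
      (Real.sinh T)).neg
    exact this.congr_deriv (by simp [neg_div])
  exact (h1.smul_const x).add (((Real.hasDerivAt_cosh s).div_const _).smul_const y)

lemma continuous_extremal (T : ℝ) (x y : E) : Continuous (extremal T x y) :=
  continuous_iff_continuousAt.2 fun s => (hasDerivAt_extremal T x y s).continuousAt

lemma continuous_extremalVelocity (T : ℝ) (x y : E) : Continuous (extremalVelocity T x y) :=
  continuous_iff_continuousAt.2 fun s => (hasDerivAt_extremalVelocity T x y s).continuousAt

lemma extremal_zero {T : ℝ} (hT : 0 < T) (x y : E) : extremal T x y 0 = x := by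
  simp [extremal, (Real.sinh_pos_iff.2 hT).ne']

lemma extremal_self {T : ℝ} (hT : 0 < T) (x y : E) : extremal T x y T = y := by
  simp [extremal, (Real.sinh_pos_iff.2 hT).ne']

lemma inner_extremalVelocity_sub {T : ℝ} (hT : 0 < T) (x y : E) :
    inner ℝ (extremalVelocity T x y T) y - inner ℝ (extremalVelocity T x y 0) x
      = lqCost T x y := by
  have := (Real.sinh_pos_iff.2 hT).ne'
  simp only [extremalVelocity, lqCost, inner_add_left, real_inner_smul_left,
    real_inner_self_eq_norm_sq, sub_self, sub_zero, Real.cosh_zero, real_inner_comm x y]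
  field_simp
  ring

lemma contDiff_extremal (T : ℝ) (x y : E) : ContDiff ℝ 1 (extremal T x y) := by
  unfold extremal
  fun_prop

lemma absolutelyContinuousOnInterval_inner_const {ξ : ℝ → E} {a b : ℝ}
    (h : AbsolutelyContinuousOnInterval ξ a b) (v : E) :
    AbsolutelyContinuousOnInterval (fun s => (inner ℝ v (ξ s) : ℝ)) a b := by
  refine squeeze_zero (fun t => Finset.sum_nonneg fun i _ => dist_nonneg) (fun t => ?_)
    (by simpa using Tendsto.const_mul ‖v‖ h)
  rw [Finset.mul_sum]
  refine Finset.sum_le_sum fun i _ => ?_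
  rw [Real.dist_eq, ← inner_sub_right, dist_eq_norm]
  exact abs_real_inner_le_norm _ _

/-- The calibrating function `⟪z', 2 ξ - z⟫` of the quadratic cost is absolutely continuous
along every absolutely continuous state `ξ`. -/
lemma absolutelyContinuousOnInterval_calibration (T : ℝ) (x y : E) {ξ : ℝ → E}
    (h : AbsolutelyContinuousOnInterval ξ 0 T) :
    AbsolutelyContinuousOnInterval
      (fun s => (inner ℝ (extremalVelocity T x y s) ((2 : ℝ) • ξ s - extremal T x y s) : ℝ))
      0 T := by
  have h1 : AbsolutelyContinuousOnInterval (fun s => -(Real.cosh (T - s) / Real.sinh T)) 0 T :=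
    ContDiffOn.absolutelyContinuousOnInterval (ContDiff.contDiffOn (by fun_prop))
  have h2 : AbsolutelyContinuousOnInterval (fun s => Real.cosh s / Real.sinh T) 0 T :=
    ContDiffOn.absolutelyContinuousOnInterval (ContDiff.contDiffOn (by fun_prop))
  have h3 : AbsolutelyContinuousOnInterval (fun s => (2 : ℝ) • ξ s - extremal T x y s) 0 T :=
    (h.const_smul (2 : ℝ)).sub
      (ContDiffOn.absolutelyContinuousOnInterval (contDiff_extremal T x y).contDiffOn)
  have := (h1.mul (absolutelyContinuousOnInterval_inner_const h3 x)).add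
    (h2.mul (absolutelyContinuousOnInterval_inner_const h3 y))
  refine Eq.mp (congrArg (AbsolutelyContinuousOnInterval · 0 T) (funext fun s => ?_)) this
  simp only [extremalVelocity, inner_add_left, real_inner_smul_left, Pi.add_apply, Pi.mul_apply]

end Extremal

/-- One half of the fundamental theorem of calculus, for an upper bound of the derivative that need
not be integrable. -/
lemma ofReal_sub_le_lintegral_of_deriv_le {G φ : ℝ → ℝ} {a b : ℝ} (hab : a ≤ b)
    (hG : AbsolutelyContinuousOnInterval G a b)
    (h : ∀ᵐ s ∂(volume.restrict (Set.Icc a b)), deriv G s ≤ φ s) :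
    ENNReal.ofReal (G b - G a) ≤ ∫⁻ s in Set.Icc a b, ENNReal.ofReal (φ s) := by
  have hint : Integrable (deriv G) (volume.restrict (Set.Icc a b)) :=
    (intervalIntegrable_iff_integrableOn_Icc_of_le hab).1 hG.intervalIntegrable_deriv
  rw [← hG.integral_deriv_eq_sub, intervalIntegral.integral_of_le hab,
    ← integral_Icc_eq_integral_Ioc]
  calc ENNReal.ofReal (∫ s in Set.Icc a b, deriv G s)
      ≤ ENNReal.ofReal (∫ s in Set.Icc a b, max (deriv G s) 0) :=
        ENNReal.ofReal_le_ofReal (integral_mono hint hint.pos_part fun s => le_max_left _ _)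
    _ = ∫⁻ s in Set.Icc a b, ENNReal.ofReal (max (deriv G s) 0) :=
        ofReal_integral_eq_lintegral_ofReal hint.pos_part (ae_of_all _ fun s => le_max_right _ _)
    _ ≤ ∫⁻ s in Set.Icc a b, ENNReal.ofReal (φ s) := by
        refine lintegral_mono_ae ?_
        filter_upwards [h] with s hs
        rw [max_comm, ENNReal.ofReal_max]
        simpa using ENNReal.ofReal_le_ofReal hs

variable {d : ℕ}

lemma reward_lqLagrangian (T : ℝ) (ξ u : ℝ → EuclideanSpace ℝ (Fin d)) :
    reward (lqLagrangian d) T ξ u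
      = -((∫⁻ s in Set.Icc 0 T, ENNReal.ofReal (‖ξ s‖ ^ 2 + ‖u s‖ ^ 2) : ℝ≥0∞) : EReal) := by
  have h1 : ∀ s, ENNReal.ofReal (lqLagrangian d (ξ s) (u s)) = 0 := fun s =>
    ENNReal.ofReal_of_nonpos (by unfold lqLagrangian; nlinarith [sq_nonneg ‖ξ s‖, sq_nonneg ‖u s‖])
  have h2 : ∀ s, -lqLagrangian d (ξ s) (u s) = ‖ξ s‖ ^ 2 + ‖u s‖ ^ 2 := fun s => by
    unfold lqLagrangian; ring
  simp only [reward, h1, h2, lintegral_zero]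
  simp

/-- Completing the square around the extremal: every trajectory costs at least `lqCost T x y`. -/
lemma lqCost_le_lintegral {T : ℝ} (hT : 0 < T) {x y : EuclideanSpace ℝ (Fin d)}
    {ξ u : ℝ → EuclideanSpace ℝ (Fin d)} (h : IsTrajectory (fun _ u => u) T x y ξ u) :
    ENNReal.ofReal (lqCost T x y)
      ≤ ∫⁻ s in Set.Icc 0 T, ENNReal.ofReal (‖ξ s‖ ^ 2 + ‖u s‖ ^ 2) := by
  have key := ofReal_sub_le_lintegral_of_deriv_le (φ := fun s => ‖ξ s‖ ^ 2 + ‖u s‖ ^ 2) hT.le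
    (absolutelyContinuousOnInterval_calibration T x y h.absolutelyContinuous_state) ?_
  · convert key using 2
    rw [extremal_zero hT, extremal_self hT, h.initial, h.final,
      ← inner_extremalVelocity_sub hT, two_smul, two_smul, add_sub_cancel_right,
      add_sub_cancel_right]
  · filter_upwards [h.dynamics] with s hs
    have hd := (hasDerivAt_extremalVelocity T x y s).inner ℝ
      ((hs.const_smul (2 : ℝ)).sub (hasDerivAt_extremal T x y s))
    refine hd.deriv.le.trans ?_
    rw [Pi.sub_apply, Pi.smul_apply]
    generalize extremalVelocity T x y s = v
    generalize extremal T x y s = z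
    -- the difference of the two sides is `|u - v|² + |ξ - z|²`
    have e1 := norm_sub_sq_real (u s) v
    have e2 := norm_sub_sq_real (ξ s) z
    simp only [inner_sub_right, real_inner_smul_right, real_inner_self_eq_norm_sq,
      real_inner_comm v, real_inner_comm z] at *
    nlinarith [sq_nonneg ‖u s - v‖, sq_nonneg ‖ξ s - z‖]

lemma isTrajectory_extremal {T : ℝ} (hT : 0 < T) (x y : EuclideanSpace ℝ (Fin d)) :
    IsTrajectory (fun _ u => u) T x y (extremal T x y) (extremalVelocity T x y) where
  measurable_control := (continuous_extremalVelocity T x y).measurable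
  absolutelyContinuous_state :=
    ContDiffOn.absolutelyContinuousOnInterval (contDiff_extremal T x y).contDiffOn
  dynamics := ae_of_all _ fun s => hasDerivAt_extremal T x y s
  initial := extremal_zero hT x y
  final := extremal_self hT x y

lemma integral_extremal {T : ℝ} (hT : 0 < T) (x y : EuclideanSpace ℝ (Fin d)) :
    ∫ s in (0 : ℝ)..T, (‖extremal T x y s‖ ^ 2 + ‖extremalVelocity T x y s‖ ^ 2)
      = lqCost T x y := by
  have hc : Continuous fun s => ‖extremal T x y s‖ ^ 2 + ‖extremalVelocity T x y s‖ ^ 2 := by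
    have := continuous_extremal T x y
    have := continuous_extremalVelocity T x y
    fun_prop
  rw [intervalIntegral.integral_eq_sub_of_hasDerivAt
    (f := fun s => (inner ℝ (extremalVelocity T x y s) (extremal T x y s) : ℝ)) (fun s _ => ?_)
    (hc.intervalIntegrable _ _)]
  · rw [extremal_zero hT, extremal_self hT, inner_extremalVelocity_sub hT]
  · have := (hasDerivAt_extremalVelocity T x y s).inner ℝ (hasDerivAt_extremal T x y s)
    simpa only [real_inner_self_eq_norm_sq, add_comm] using this

lemma lintegral_extremal {T : ℝ} (hT : 0 < T) (x y : EuclideanSpace ℝ (Fin d)) :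
    ∫⁻ s in Set.Icc 0 T,
        ENNReal.ofReal (‖extremal T x y s‖ ^ 2 + ‖extremalVelocity T x y s‖ ^ 2)
      = ENNReal.ofReal (lqCost T x y) := by
  have hc : Continuous fun s => ‖extremal T x y s‖ ^ 2 + ‖extremalVelocity T x y s‖ ^ 2 := by
    have := continuous_extremal T x y
    have := continuous_extremalVelocity T x y
    fun_prop
  rw [← integral_extremal hT, intervalIntegral.integral_of_le hT.le,
    ← integral_Icc_eq_integral_Ioc,
    ofReal_integral_eq_lintegral_ofReal (hc.integrableOn_Icc) (ae_of_all _ fun s => by positivity)]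

lemma lqCost_nonneg {T : ℝ} (hT : 0 < T) (x y : EuclideanSpace ℝ (Fin d)) :
    0 ≤ lqCost T x y := by
  rw [← integral_extremal hT]
  exact intervalIntegral.integral_nonneg hT.le fun s _ => by positivity

lemma laxOleinikKernel_lq {T : ℝ} (hT : 0 < T) (x y : EuclideanSpace ℝ (Fin d)) :
    laxOleinikKernel (fun _ u => u) (lqLagrangian d) T x y = ((-lqCost T x y : ℝ) : EReal) := by
  have hcoe : ((ENNReal.ofReal (lqCost T x y) : ℝ≥0∞) : EReal) = (lqCost T x y : ℝ) := by
    rw [EReal.coe_ennreal_ofReal, max_eq_left (lqCost_nonneg hT x y)]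
  rw [EReal.coe_neg, ← hcoe]
  refine le_antisymm ?_ ?_
  · refine iSup_le fun ξ => iSup_le fun u => iSup_le fun h => ?_
    rw [reward_lqLagrangian, EReal.neg_le_neg_iff]
    exact_mod_cast lqCost_le_lintegral hT h
  · refine le_iSup_of_le (extremal T x y) (le_iSup_of_le (extremalVelocity T x y)
      (le_iSup_of_le (isTrajectory_extremal hT x y) ?_))
    rw [reward_lqLagrangian, lintegral_extremal hT]

lemma lqKernel_of_pos (lam : ℝ) {T : ℝ} (hT : 0 < T) (x y : EuclideanSpace ℝ (Fin d)) :
    lqKernel d lam T x y = ((-lqCost T x y - lam * T : ℝ) : EReal) := by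
  rw [lqKernel, normalisedKernel, laxOleinikKernel_lq hT, ← EReal.coe_add]
  congr 1
  ring

/-- At horizon `0` the only trajectory is a constant one, so that the kernel is `-∞` off the
diagonal. -/
lemma lqKernel_zero (lam : ℝ) (x y : EuclideanSpace ℝ (Fin d)) :
    lqKernel d lam 0 x y = if x = y then 0 else ⊥ := by
  have hr : ∀ ξ u : ℝ → EuclideanSpace ℝ (Fin d), reward (lqLagrangian d) 0 ξ u = 0 := by
    intro ξ u
    simp [reward_lqLagrangian]
  have : laxOleinikKernel (fun _ u => u) (lqLagrangian d) 0 x y = if x = y then 0 else ⊥ := by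
    split_ifs with hxy
    · refine le_antisymm ?_ ?_
      · exact iSup_le fun ξ => iSup_le fun u => iSup_le fun h => (hr ξ u).le
      · refine le_iSup_of_le (fun _ => x) (le_iSup_of_le (fun _ => 0)
          (le_iSup_of_le ?_ (hr _ _).ge))
        exact ⟨measurable_const,
          ContDiffOn.absolutelyContinuousOnInterval contDiff_const.contDiffOn,
          ae_of_all _ fun s => hasDerivAt_const s x, rfl, hxy⟩
    · exact eq_bot_iff.2 (iSup_le fun ξ => iSup_le fun u => iSup_le fun h =>
        absurd (h.initial.symm.trans h.final) hxy)
  rw [lqKernel, normalisedKernel, this]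
  split_ifs <;> simp

/-! ### Optimising over the horizon -/

/-- With `a = |x|² + |y|²` and `b = x · y`, the optimal horizon `T` for `lam > 0` satisfies
`lam * cosh T = starRoot lam a b - b`. -/
def starRoot (lam a b : ℝ) : ℝ := √(b ^ 2 + lam * (a + lam))

/-- The value of `sup_T (-(a cosh T - 2 b) / sinh T - lam T)`. The same expression is correct for
`lam = 0`: the last term, with its division by `0`, is then multiplied by `0`. -/
def starValue (lam a b : ℝ) : ℝ :=
  -√((a + lam) ^ 2 - (b + starRoot lam a b) ^ 2)
    - lam * Real.arcosh ((starRoot lam a b - b) / lam)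

section Scalar

variable {lam a b : ℝ}

lemma starRoot_sq (hl : 0 ≤ lam) (ha : 0 ≤ a) : starRoot lam a b ^ 2 = b ^ 2 + lam * (a + lam) :=
  Real.sq_sqrt (by positivity)

lemma abs_le_starRoot (hl : 0 ≤ lam) (ha : 0 ≤ a) : |b| ≤ starRoot lam a b :=
  Real.abs_le_sqrt (by nlinarith [mul_nonneg hl (add_nonneg ha hl)])

lemma starRoot_zero (a b : ℝ) : starRoot 0 a b = |b| := by
  simp [starRoot, Real.sqrt_sq_eq_abs]

lemma one_le_starRoot_sub_div (hl : 0 < lam) (hab : 2 * b ≤ a) :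
    1 ≤ (starRoot lam a b - b) / lam := by
  rw [le_div_iff₀ hl, one_mul, le_sub_iff_add_le]
  exact Real.le_sqrt_of_sq_le (by nlinarith)

lemma one_lt_starRoot_sub_div (hl : 0 < lam) (hab : 2 * b < a) :
    1 < (starRoot lam a b - b) / lam := by
  rw [lt_div_iff₀ hl, one_mul, lt_sub_iff_add_lt]
  exact Real.lt_sqrt_of_sq_lt (by nlinarith)

lemma starRoot_of_eq (hl : 0 < lam) (hb : 0 ≤ b) : starRoot lam (2 * b) b = b + lam := by
  rw [starRoot, show b ^ 2 + lam * (2 * b + lam) = (b + lam) ^ 2 by ring,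
    Real.sqrt_sq (by positivity)]

lemma starValue_diag (hl : 0 ≤ lam) (hb : 0 ≤ b) : starValue lam (2 * b) b = 0 := by
  rcases hl.eq_or_lt with rfl | hl
  · rw [starValue, starRoot_zero, abs_of_nonneg hb]
    ring_nf
    simp
  · rw [starValue, starRoot_of_eq hl hb]
    ring_nf
    rw [mul_inv_cancel₀ hl.ne', Real.arcosh_zero]
    simp

lemma starValue_zero_of_nonpos (ha : 0 ≤ a) (hb : b ≤ 0) : starValue 0 a b = -a := by
  rw [starValue, starRoot_zero, abs_of_nonpos hb]
  simp [Real.sqrt_sq ha]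

lemma starValue_zero_of_nonneg (hb : 0 ≤ b) : starValue 0 a b = -√(a ^ 2 - (2 * b) ^ 2) := by
  rw [starValue, starRoot_zero, abs_of_nonneg hb]
  simp [two_mul]

/-- The value at the optimal horizon. -/
lemma starValue_eq_of_pos (hl : 0 < lam) (ha : 0 ≤ a) (hab : 2 * b < a) :
    starValue lam a b =
      -((a * Real.cosh (Real.arcosh ((starRoot lam a b - b) / lam)) - 2 * b)
          / Real.sinh (Real.arcosh ((starRoot lam a b - b) / lam)))
        - lam * Real.arcosh ((starRoot lam a b - b) / lam) := by
  have hC := one_lt_starRoot_sub_div hl hab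
  have hD := starRoot_sq (b := b) hl.le ha
  have hbD : 0 ≤ b + starRoot lam a b := by
    have := abs_le_starRoot (b := b) hl.le ha
    have := neg_abs_le b
    linarith
  rw [Real.cosh_arcosh hC.le, Real.sinh_arcosh hC.le, starValue]
  set D := starRoot lam a b
  set C := (D - b) / lam with hCdef
  have hlC : lam * C = D - b := by rw [hCdef]; field_simp
  have hCD : C * (b + D) = a + lam := by
    rw [hCdef]; field_simp; linarith
  have hs : 0 < C ^ 2 - 1 := by nlinarith
  have h1 : (a + lam) ^ 2 - (b + D) ^ 2 = (b + D) ^ 2 * (C ^ 2 - 1) := by rw [← hCD]; ring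
  have h2 : a * C - 2 * b = (b + D) * (√(C ^ 2 - 1)) ^ 2 := by
    rw [Real.sq_sqrt hs.le]; linear_combination -C * hCD - hlC
  rw [h1, Real.sqrt_mul (sq_nonneg _), Real.sqrt_sq hbD, h2, mul_div_assoc,
    pow_two (√_), mul_self_div_self]

lemma hasDerivAt_horizon (lam a b : ℝ) {T : ℝ} (hT : 0 < T) :
    HasDerivAt (fun T => -((a * Real.cosh T - 2 * b) / Real.sinh T) - lam * T)
      ((a - 2 * b * Real.cosh T - lam * (Real.cosh T ^ 2 - 1)) / Real.sinh T ^ 2) T := by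
  have hs := (Real.sinh_pos_iff.2 hT).ne'
  have := ((((Real.hasDerivAt_cosh T).const_mul a).sub_const (2 * b)).div
    (Real.hasDerivAt_sinh T) hs).neg.sub ((hasDerivAt_id T).const_mul lam)
  refine this.congr_deriv ?_
  field_simp
  linear_combination (a + lam) * Real.cosh_sq T

/-- The derivative in the horizon has the sign of `C - cosh T`, where `lam * C = starRoot - b`. -/
lemma horizon_deriv_numerator (hl : 0 < lam) (ha : 0 ≤ a) (c : ℝ) :
    a - 2 * b * c - lam * (c ^ 2 - 1)
      = ((starRoot lam a b - b) / lam - c) * (lam * c + (starRoot lam a b + b)) := by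
  have hD := starRoot_sq (b := b) hl.le ha
  field_simp
  linear_combination -hD

lemma horizon_le_starValue (hl : 0 ≤ lam) (hab : 2 * |b| ≤ a) {T : ℝ} (hT : 0 < T) :
    -((a * Real.cosh T - 2 * b) / Real.sinh T) - lam * T ≤ starValue lam a b := by
  have hs := Real.sinh_pos_iff.2 hT
  have hc := Real.one_le_cosh T
  have hcs := Real.cosh_sq T
  have hba := le_abs_self b
  have ha : 0 ≤ a := by linarith [abs_nonneg b]
  rcases hl.eq_or_lt with rfl | hl
  · -- `(a cosh T - 2 b)² - (a² - 4 b²) sinh² T = (a - 2 b cosh T)²`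
    rw [zero_mul, sub_zero, neg_le, le_div_iff₀ hs]
    rcases le_total b 0 with hb | hb
    · rw [starValue_zero_of_nonpos ha hb, neg_neg]
      nlinarith [Real.sinh_lt_cosh T]
    · rw [starValue_zero_of_nonneg hb, neg_neg]
      rw [← Real.sqrt_sq hs.le, ← Real.sqrt_mul' _ (sq_nonneg _)]
      refine Real.sqrt_le_iff.2 ⟨by nlinarith, ?_⟩
      nlinarith [sq_nonneg (a - 2 * b * Real.cosh T)]
  rcases (show 2 * b ≤ a by linarith).eq_or_lt with rfl | hab'
  · rw [starValue_diag hl.le (by linarith)]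
    have : 0 ≤ (2 * b * Real.cosh T - 2 * b) / Real.sinh T :=
      div_nonneg (by nlinarith) hs.le
    nlinarith
  rw [starValue_eq_of_pos hl ha hab']
  have hC := one_lt_starRoot_sub_div hl hab'
  have hDb : 0 ≤ starRoot lam a b + b := by
    have := abs_le_starRoot (b := b) hl.le ha
    have := neg_abs_le b
    linarith
  have hnum := horizon_deriv_numerator (b := b) hl ha
  have hcC := Real.cosh_arcosh hC.le
  have hT0 := Real.arcosh_pos hC
  generalize (starRoot lam a b - b) / lam = C at *
  generalize hT' : Real.arcosh C = T₀ at *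
  have hpos : ∀ t, 0 ≤ lam * Real.cosh t + (starRoot lam a b + b) := fun t => by
    have := Real.cosh_pos t
    positivity
  rcases le_total T T₀ with h | h
  · refine monotoneOn_of_deriv_nonneg (convex_Ioc 0 T₀)
      (fun t ht => (hasDerivAt_horizon lam a b ht.1).continuousAt.continuousWithinAt)
      (fun t ht => ?_) (fun t ht => ?_) ⟨hT, h⟩ ⟨hT0, le_rfl⟩ h
    all_goals rw [interior_Ioc] at ht
    · exact (hasDerivAt_horizon lam a b ht.1).differentiableAt.differentiableWithinAt
    · rw [(hasDerivAt_horizon lam a b ht.1).deriv, hnum]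
      refine div_nonneg (mul_nonneg ?_ (hpos t)) (sq_nonneg _)
      rw [← hcC, sub_nonneg, Real.cosh_le_cosh, abs_of_pos ht.1, abs_of_pos hT0]
      exact ht.2.le
  · refine antitoneOn_of_deriv_nonpos (convex_Ici T₀)
      (fun t ht => (hasDerivAt_horizon lam a b (hT0.trans_le ht)).continuousAt.continuousWithinAt)
      (fun t ht => ?_) (fun t ht => ?_) (Set.self_mem_Ici) h h
    all_goals
      rw [interior_Ici] at ht
      have ht0 : 0 < t := hT0.trans ht
    · exact (hasDerivAt_horizon lam a b ht0).differentiableAt.differentiableWithinAt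
    · rw [(hasDerivAt_horizon lam a b ht0).deriv, hnum]
      refine div_nonpos_of_nonpos_of_nonneg
        (mul_nonpos_of_nonpos_of_nonneg ?_ (hpos t)) (sq_nonneg _)
      rw [← hcC, sub_nonpos, Real.cosh_le_cosh, abs_of_pos ht0, abs_of_pos hT0]
      exact (le_of_lt ht)

lemma tendsto_sinh_atTop : Tendsto Real.sinh atTop atTop := by
  refine tendsto_atTop_mono' _ ?_ tendsto_id
  filter_upwards [eventually_ge_atTop 0] with t ht using Real.self_le_sinh_iff.2 ht

lemma tendsto_horizon_atTop (a b : ℝ) :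
    Tendsto (fun T => -((a * Real.cosh T - 2 * b) / Real.sinh T)) atTop (𝓝 (-a)) := by
  -- `cosh T = sinh T + exp (-T)`
  have h : Tendsto (fun T => a + (a * Real.exp (-T) - 2 * b) / Real.sinh T) atTop
      (𝓝 (a + 0)) :=
    tendsto_const_nhds.add (((Real.tendsto_exp_neg_atTop_nhds_zero.const_mul a).sub_const
      (2 * b)).div_atTop tendsto_sinh_atTop)
  rw [add_zero] at h
  refine h.neg.congr' ?_
  filter_upwards [eventually_gt_atTop 0] with T hT
  have := (Real.sinh_pos_iff.2 hT).ne'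
  rw [← Real.cosh_sub_sinh]
  field_simp
  ring

end Scalar

section Star

variable {d : ℕ} {lam : ℝ}

/-- The real-valued function equal to the kernel `A^*` for `lam ≥ 0`, see `starKernel_lq`. -/
def lqStar {E : Type*} [NormedAddCommGroup E] [InnerProductSpace ℝ E] (lam : ℝ) (x y : E) : ℝ :=
  starValue lam (‖x‖ ^ 2 + ‖y‖ ^ 2) (inner ℝ x y)

variable {E : Type*} [NormedAddCommGroup E] [InnerProductSpace ℝ E]

lemma two_mul_abs_inner_le (x y : E) : 2 * |inner ℝ x y| ≤ ‖x‖ ^ 2 + ‖y‖ ^ 2 := by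
  nlinarith [abs_real_inner_le_norm x y, sq_nonneg (‖x‖ - ‖y‖)]

lemma two_mul_inner_le (x y : E) : 2 * inner ℝ x y ≤ ‖x‖ ^ 2 + ‖y‖ ^ 2 :=
  le_trans (by linarith [le_abs_self (inner ℝ x y : ℝ)]) (two_mul_abs_inner_le x y)

lemma two_mul_inner_lt {x y : E} (h : x ≠ y) : 2 * inner ℝ x y < ‖x‖ ^ 2 + ‖y‖ ^ 2 := by
  have h1 := norm_sub_sq_real x y
  have h2 : 0 < ‖x - y‖ := norm_pos_iff.2 (sub_ne_zero.2 h)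
  nlinarith

lemma lqStar_self (hl : 0 ≤ lam) (x : E) : lqStar lam x x = 0 := by
  rw [lqStar, real_inner_self_eq_norm_sq, ← two_mul]
  exact starValue_diag hl (sq_nonneg _)

lemma coe_le_starKernel (lam : ℝ) {T : ℝ} (hT : 0 < T) (x y : EuclideanSpace ℝ (Fin d)) :
    ((-lqCost T x y - lam * T : ℝ) : EReal) ≤ starKernel (lqKernel d lam) x y :=
  le_iSup_of_le T (le_iSup_of_le hT.le (lqKernel_of_pos lam hT x y).ge)

lemma lqStar_le_starKernel (hl : 0 ≤ lam) (x y : EuclideanSpace ℝ (Fin d)) :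
    (lqStar lam x y : EReal) ≤ starKernel (lqKernel d lam) x y := by
  rcases eq_or_ne x y with rfl | hxy
  · rw [lqStar_self hl]
    exact le_iSup_of_le 0 (le_iSup_of_le le_rfl (by simp [lqKernel_zero]))
  have hab := two_mul_inner_lt hxy
  have ha : 0 ≤ ‖x‖ ^ 2 + ‖y‖ ^ 2 := by positivity
  rcases hl.eq_or_lt with rfl | hl
  · rcases le_or_gt (inner ℝ x y : ℝ) 0 with hb | hb
    · -- the supremum is not attained: it is the limit for `T → ∞`
      rw [lqStar, starValue_zero_of_nonpos ha hb]
      refine le_of_tendsto (x := atTop)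
        ((continuous_coe_real_ereal.tendsto _).comp (tendsto_horizon_atTop _ (inner ℝ x y))) ?_
      filter_upwards [eventually_gt_atTop 0] with T hT
      refine le_trans (le_of_eq ?_) (coe_le_starKernel 0 hT x y)
      simp [lqCost]
    · -- the supremum is attained where `cosh T = a / (2 b)`
      have hC : 1 < (‖x‖ ^ 2 + ‖y‖ ^ 2) / (2 * inner ℝ x y) := by
        rwa [lt_div_iff₀ (by positivity), one_mul]
      refine le_trans (le_of_eq ?_) (coe_le_starKernel 0 (Real.arcosh_pos hC) x y)
      rw [lqStar, starValue_zero_of_nonneg hb.le, lqCost, Real.cosh_arcosh hC.le,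
        Real.sinh_arcosh hC.le, zero_mul, sub_zero]
      congr 2
      set a := ‖x‖ ^ 2 + ‖y‖ ^ 2
      set b : ℝ := inner ℝ x y
      have hb2 : 0 < 2 * b := by positivity
      have hs : 0 < (a / (2 * b)) ^ 2 - 1 := by nlinarith
      have h1 : a ^ 2 - (2 * b) ^ 2 = (2 * b) ^ 2 * ((a / (2 * b)) ^ 2 - 1) := by
        field_simp
      have h2 : a * (a / (2 * b)) - 2 * b = 2 * b * √((a / (2 * b)) ^ 2 - 1) ^ 2 := by
        rw [Real.sq_sqrt hs.le]; field_simp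
      rw [h1, Real.sqrt_mul (sq_nonneg _), Real.sqrt_sq hb2.le, h2,
        mul_div_assoc, pow_two (√_), mul_self_div_self]
  · rw [lqStar, starValue_eq_of_pos hl ha hab]
    exact coe_le_starKernel lam (Real.arcosh_pos (one_lt_starRoot_sub_div hl hab)) x y

lemma starKernel_lq (hl : 0 ≤ lam) (x y : EuclideanSpace ℝ (Fin d)) :
    starKernel (lqKernel d lam) x y = (lqStar lam x y : EReal) := by
  refine le_antisymm (iSup_le fun T => iSup_le fun hT => ?_) (lqStar_le_starKernel hl x y)
  rcases hT.eq_or_lt with rfl | hT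
  · rw [lqKernel_zero]
    split_ifs with h
    · rw [h, lqStar_self hl, EReal.coe_zero]
    · exact bot_le
  · rw [lqKernel_of_pos lam hT]
    exact_mod_cast horizon_le_starValue hl (two_mul_abs_inner_le x y) hT

lemma lqStar_nonpos (hl : 0 ≤ lam) (x y : E) : lqStar lam x y ≤ 0 := by
  have h1 : 0 ≤ lam * Real.arcosh ((starRoot lam (‖x‖ ^ 2 + ‖y‖ ^ 2) (inner ℝ x y)
      - inner ℝ x y) / lam) := by
    rcases hl.eq_or_lt with rfl | hl
    · simp
    · exact mul_nonneg hl.le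
        (Real.arcosh_nonneg (one_le_starRoot_sub_div hl (two_mul_inner_le x y)))
  have h2 := Real.sqrt_nonneg ((‖x‖ ^ 2 + ‖y‖ ^ 2 + lam) ^ 2
    - (inner ℝ x y + starRoot lam (‖x‖ ^ 2 + ‖y‖ ^ 2) (inner ℝ x y)) ^ 2)
  unfold lqStar starValue
  linarith

lemma continuous_lqStar (hl : 0 ≤ lam) (x : E) : Continuous (lqStar lam x) := by
  unfold lqStar starValue
  have hD : Continuous fun y : E => starRoot lam (‖x‖ ^ 2 + ‖y‖ ^ 2) (inner ℝ x y) := by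
    unfold starRoot
    fun_prop
  refine Continuous.sub (by fun_prop) ?_
  rcases hl.eq_or_lt with rfl | hl
  · simpa using continuous_const
  · exact continuous_const.mul (Real.continuousOn_arcosh.comp_continuous (by fun_prop)
      fun y => one_le_starRoot_sub_div hl (two_mul_inner_le x y))

lemma lqStar_zero_of_nonpos {x y : E} (h : inner ℝ x y ≤ (0 : ℝ)) :
    lqStar 0 x y = -‖x‖ ^ 2 - ‖y‖ ^ 2 := by
  rw [lqStar, starValue_zero_of_nonpos (by positivity) h]
  ring

lemma lqStar_zero_of_pos {x y : E} (h : (0 : ℝ) < inner ℝ x y) :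
    lqStar 0 x y = -(‖x - y‖ * ‖x + y‖) := by
  rw [lqStar, starValue_zero_of_nonneg h.le,
    ← Real.sqrt_sq (show 0 ≤ ‖x - y‖ * ‖x + y‖ by positivity), mul_pow ‖x - y‖,
    norm_sub_sq_real, norm_add_sq_real]
  congr 2
  ring

lemma lqStar_zero_left (hl : 0 < lam) (y : E) :
    lqStar lam 0 y = -(‖y‖ * √(lam + ‖y‖ ^ 2)) - lam * Real.log (√(lam + ‖y‖ ^ 2) + ‖y‖)
      + lam * Real.log √lam := by
  have hs : 0 < √lam := Real.sqrt_pos.2 hl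
  have hss : √lam ^ 2 = lam := Real.sq_sqrt hl.le
  have hr : 0 < √(lam + ‖y‖ ^ 2) := Real.sqrt_pos.2 (by positivity)
  have hrr : √(lam + ‖y‖ ^ 2) ^ 2 = lam + ‖y‖ ^ 2 := Real.sq_sqrt (by positivity)
  have hD : starRoot lam (‖(0 : E)‖ ^ 2 + ‖y‖ ^ 2) (inner ℝ (0 : E) y)
      = √lam * √(lam + ‖y‖ ^ 2) := by
    rw [starRoot, ← Real.sqrt_mul hl.le]
    simp [add_comm]
  have h1 : (‖(0 : E)‖ ^ 2 + ‖y‖ ^ 2 + lam) ^ 2 - (inner ℝ (0 : E) y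
      + √lam * √(lam + ‖y‖ ^ 2)) ^ 2 = (‖y‖ * √(lam + ‖y‖ ^ 2)) ^ 2 := by
    rw [inner_zero_left, zero_add, mul_pow, mul_pow, hss, hrr, norm_zero]
    ring
  have h2 : (√lam * √(lam + ‖y‖ ^ 2) - (inner ℝ (0 : E) y)) / lam = √(lam + ‖y‖ ^ 2) / √lam := by
    rw [inner_zero_left, sub_zero, div_eq_div_iff hl.ne' hs.ne']
    linear_combination √(lam + ‖y‖ ^ 2) * hss
  have h3 : (√(lam + ‖y‖ ^ 2) / √lam) ^ 2 - 1 = (‖y‖ / √lam) ^ 2 := by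
    rw [div_pow, div_pow, hss, hrr]
    field_simp
    ring
  rw [lqStar, starValue, hD, h1, h2, Real.sqrt_sq (by positivity), Real.arcosh, h3,
    Real.sqrt_sq (by positivity), ← add_div, Real.log_div (by positivity) hs.ne']
  ring

end Star

/-! ### The Martin kernel at infinity -/

lemma lt_sqrt_sq_add {lam : ℝ} (hl : 0 < lam) (p : ℝ) : p < √(p ^ 2 + lam) :=
  calc p ≤ |p| := le_abs_self _
    _ = √(p ^ 2) := (Real.sqrt_sq_eq_abs _).symm
    _ < √(p ^ 2 + lam) := Real.sqrt_lt_sqrt (sq_nonneg _) (by linarith)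

section Asymptotics

variable {ι : Type*} {l : Filter ι} {r p : ι → ℝ} {lam m p₀ : ℝ}

lemma starRoot_mul {r : ℝ} (hr : 0 < r) (lam m p : ℝ) :
    starRoot lam (m + r ^ 2) (r * p) = r * √(p ^ 2 + lam * (1 + (m + lam) * (r⁻¹) ^ 2)) := by
  rw [starRoot, show (r * p) ^ 2 + lam * (m + r ^ 2 + lam)
    = r ^ 2 * (p ^ 2 + lam * (1 + (m + lam) * (r⁻¹) ^ 2)) by field_simp; ring,
    Real.sqrt_mul (sq_nonneg _), Real.sqrt_sq hr.le]

lemma tendsto_rescaled_starRoot (lam m : ℝ) (hr : Tendsto r l atTop) (hp : Tendsto p l (𝓝 p₀)) :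
    Tendsto (fun i => √(p i ^ 2 + lam * (1 + (m + lam) * ((r i)⁻¹) ^ 2))) l
      (𝓝 √(p₀ ^ 2 + lam)) := by
  have hr' : Tendsto (fun i => (r i)⁻¹) l (𝓝 0) := hr.inv_tendsto_atTop
  have := ((hp.pow 2).add (((hr'.pow 2).const_mul (m + lam)).const_add 1 |>.const_mul lam)).sqrt
  simpa using this

/-- The algebraic part of `A^* (x, y)`, up to `o(1)` for `|y| → ∞`. Here `r = |y|`, `m = |x|²` and
`r * p = x · y`. -/
lemma tendsto_sq_sub_sqrt (lam m : ℝ) (hr : Tendsto r l atTop) (hp : Tendsto p l (𝓝 p₀)) :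
    Tendsto (fun i => r i ^ 2 - √((m + r i ^ 2 + lam) ^ 2
        - (r i * p i + starRoot lam (m + r i ^ 2) (r i * p i)) ^ 2)) l
      (𝓝 ((p₀ + √(p₀ ^ 2 + lam)) ^ 2 / 2 - (m + lam))) := by
  have hr' : Tendsto (fun i => (r i)⁻¹) l (𝓝 0) := hr.inv_tendsto_atTop
  have hS := hp.add (tendsto_rescaled_starRoot lam m hr hp)
  set S : ι → ℝ := fun i => p i + √(p i ^ 2 + lam * (1 + (m + lam) * ((r i)⁻¹) ^ 2))
  have hq : Tendsto (fun i => (1 + (m + lam) * (r i)⁻¹ ^ 2) ^ 2 - (S i * (r i)⁻¹) ^ 2) l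
      (𝓝 1) := by
    have := ((((hr'.pow 2).const_mul (m + lam)).const_add 1).pow 2).sub ((hS.mul hr').pow 2)
    simpa using this
  -- rationalise the difference and divide by `r ^ 2`
  have hmain : Tendsto (fun i => (S i ^ 2 - 2 * (m + lam) - (m + lam) ^ 2 * (r i)⁻¹ ^ 2)
      / (1 + √((1 + (m + lam) * (r i)⁻¹ ^ 2) ^ 2 - (S i * (r i)⁻¹) ^ 2))) l
      (𝓝 (((p₀ + √(p₀ ^ 2 + lam)) ^ 2 - 2 * (m + lam) - (m + lam) ^ 2 * 0 ^ 2) / (1 + √1))) :=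
    (((hS.pow 2).sub_const _).sub ((hr'.pow 2).const_mul _)).div (hq.sqrt.const_add 1)
      (by norm_num)
  rw [Real.sqrt_one] at hmain
  convert hmain.congr' ?_ using 2
  · ring
  · filter_upwards [hr.eventually_gt_atTop 0, hq.eventually (lt_mem_nhds one_pos)] with i hi hqi
    have h1 : r i * p i + starRoot lam (m + r i ^ 2) (r i * p i) = r i * S i := by
      rw [starRoot_mul hi, ← mul_add]
    have h2 : (m + r i ^ 2 + lam) ^ 2 - (r i * S i) ^ 2 = (r i ^ 2) ^ 2 *
        ((1 + (m + lam) * (r i)⁻¹ ^ 2) ^ 2 - (S i * (r i)⁻¹) ^ 2) := by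
      field_simp
      ring
    rw [h1, h2, Real.sqrt_mul (sq_nonneg _), Real.sqrt_sq (sq_nonneg _)]
    have h3 := Real.sq_sqrt hqi.le
    have h4 := Real.sqrt_nonneg ((1 + (m + lam) * (r i)⁻¹ ^ 2) ^ 2 - (S i * (r i)⁻¹) ^ 2)
    generalize √((1 + (m + lam) * (r i)⁻¹ ^ 2) ^ 2 - (S i * (r i)⁻¹) ^ 2) = w at *
    rw [div_eq_iff (by positivity)]
    have h5 : r i * (r i)⁻¹ = 1 := mul_inv_cancel₀ hi.ne'
    generalize (r i)⁻¹ = ρ at *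
    have h6 : r i ^ 2 * ρ ^ 2 = 1 := by rw [← mul_pow, h5, one_pow]
    linear_combination r i ^ 2 * h3 + (2 * (m + lam) + (m + lam) ^ 2 * ρ ^ 2 - S i ^ 2) * h6

/-- The logarithmic part of `A^* (x, y)`, up to `o(1)` for `|y| → ∞`, where again `r = |y|`,
`m = |x|²` and `r * p = x · y`. -/
lemma tendsto_arcosh_sub_log (hl : 0 < lam) (m : ℝ) (hr : Tendsto r l atTop)
    (hp : Tendsto p l (𝓝 p₀)) :
    Tendsto (fun i => Real.arcosh ((starRoot lam (m + r i ^ 2) (r i * p i) - r i * p i) / lam)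
        - Real.log (r i)) l (𝓝 (Real.log (2 * (√(p₀ ^ 2 + lam) - p₀) / lam))) := by
  have hr' : Tendsto (fun i => (r i)⁻¹) l (𝓝 0) := hr.inv_tendsto_atTop
  have hR := ((tendsto_rescaled_starRoot lam m hr hp).sub hp).div_const lam
  set R : ι → ℝ := fun i => (√(p i ^ 2 + lam * (1 + (m + lam) * ((r i)⁻¹) ^ 2)) - p i) / lam
  have hR0 : 0 < (√(p₀ ^ 2 + lam) - p₀) / lam :=
    div_pos (sub_pos.2 (lt_sqrt_sq_add hl p₀)) hl
  have hlim : Tendsto (fun i => R i + √(R i ^ 2 - (r i)⁻¹ ^ 2)) l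
      (𝓝 (2 * (√(p₀ ^ 2 + lam) - p₀) / lam)) := by
    have := hR.add ((hR.pow 2).sub (hr'.pow 2)).sqrt
    rwa [zero_pow two_ne_zero, sub_zero, Real.sqrt_sq hR0.le, ← two_mul, ← mul_div_assoc] at this
  have hpos : 0 < 2 * (√(p₀ ^ 2 + lam) - p₀) / lam := by rw [mul_div_assoc]; positivity
  refine (hlim.log hpos.ne').congr' ?_
  filter_upwards [hr.eventually_gt_atTop 0, hlim.eventually (lt_mem_nhds hpos)] with i hi hLi
  have h1 : (starRoot lam (m + r i ^ 2) (r i * p i) - r i * p i) / lam = r i * R i := by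
    rw [starRoot_mul hi, ← mul_sub, mul_div_assoc]
  have h2 : (r i * R i) ^ 2 - 1 = r i ^ 2 * (R i ^ 2 - (r i)⁻¹ ^ 2) := by
    field_simp
  rw [h1, Real.arcosh, h2, Real.sqrt_mul (sq_nonneg _), Real.sqrt_sq hi.le, ← mul_add,
    Real.log_mul hi.ne' hLi.ne', add_sub_cancel_left]

variable {E : Type*} [NormedAddCommGroup E] [InnerProductSpace ℝ E] {l : Filter E} {n : E}

lemma inner_eq_norm_mul_inner_direction (x y : E) :
    (inner ℝ x y : ℝ) = ‖y‖ * inner ℝ x (‖y‖⁻¹ • y) := by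
  rcases eq_or_ne y 0 with rfl | hy
  · simp
  · rw [real_inner_smul_right, mul_inv_cancel_left₀ (norm_ne_zero_iff.2 hy)]

lemma tendsto_inner_direction (hn : Tendsto (fun y : E => ‖y‖⁻¹ • y) l (𝓝 n)) (x : E) :
    Tendsto (fun y : E => (inner ℝ x (‖y‖⁻¹ • y) : ℝ)) l (𝓝 (inner ℝ x n)) :=
  tendsto_const_nhds.inner hn

/-- The limit of the Martin kernel for `lam = 0`, when `y` goes to infinity in the direction `n`. -/
lemma tendsto_martin_zero (hy : Tendsto (fun y : E => ‖y‖) l atTop)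
    (hn : Tendsto (fun y : E => ‖y‖⁻¹ • y) l (𝓝 n)) (x : E) :
    Tendsto (fun y => lqStar 0 x y - lqStar 0 0 y) l
      (𝓝 ((inner ℝ x n + |inner ℝ x n|) ^ 2 / 2 - ‖x‖ ^ 2)) := by
  have h := tendsto_sq_sub_sqrt 0 (‖x‖ ^ 2) hy (tendsto_inner_direction hn x)
  simp only [← inner_eq_norm_mul_inner_direction] at h
  simp only [add_zero, Real.sqrt_sq_eq_abs] at h
  refine h.congr fun y => ?_
  rw [lqStar_zero_of_nonpos (x := (0 : E)) (by simp)]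
  simp [lqStar, starValue]
  ring

/-- The limit of the Martin kernel for `lam > 0`, when `y` goes to infinity in the direction `n`.
The divergent terms `|y|²` and `lam * log |y|` do not depend on `x` and cancel. -/
lemma tendsto_martin_pos (hl : 0 < lam) (hy : Tendsto (fun y : E => ‖y‖) l atTop)
    (hn : Tendsto (fun y : E => ‖y‖⁻¹ • y) l (𝓝 n)) (x : E) :
    Tendsto (fun y => lqStar lam x y - lqStar lam 0 y) l
      (𝓝 ((inner ℝ x n + √(inner ℝ x n ^ 2 + lam)) ^ 2 / 2 - lam / 2 - ‖x‖ ^ 2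
        - lam * Real.log ((√(inner ℝ x n ^ 2 + lam) - inner ℝ x n) / √lam))) := by
  have key : ∀ x : E, Tendsto (fun y => lqStar lam x y + ‖y‖ ^ 2 + lam * Real.log ‖y‖) l
      (𝓝 ((inner ℝ x n + √(inner ℝ x n ^ 2 + lam)) ^ 2 / 2 - (‖x‖ ^ 2 + lam)
        - lam * Real.log (2 * (√(inner ℝ x n ^ 2 + lam) - inner ℝ x n) / lam))) := by
    intro x
    have h1 := tendsto_sq_sub_sqrt lam (‖x‖ ^ 2) hy (tendsto_inner_direction hn x)
    have h2 := tendsto_arcosh_sub_log hl (‖x‖ ^ 2) hy (tendsto_inner_direction hn x)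
    have h := h1.sub (h2.const_mul lam)
    simp only [← inner_eq_norm_mul_inner_direction] at h
    refine h.congr fun y => ?_
    rw [lqStar, starValue]
    ring
  convert ((key x).sub (key 0)).congr fun y => ?_ using 2
  · have hs : 0 < √lam := Real.sqrt_pos.2 hl
    have hss : √lam ^ 2 = lam := Real.sq_sqrt hl.le
    have hR : 0 < √(inner ℝ x n ^ 2 + lam) - inner ℝ x n :=
      sub_pos.2 (lt_sqrt_sq_add hl _)
    have h0 : (inner ℝ (0 : E) n : ℝ) = 0 := inner_zero_left _
    rw [h0, norm_zero, zero_pow two_ne_zero, zero_add, zero_add, sub_zero, hss,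
      Real.log_div (by positivity) hl.ne', Real.log_div (by positivity) hl.ne',
      Real.log_mul two_ne_zero hR.ne', Real.log_mul two_ne_zero hs.ne',
      Real.log_div hR.ne' hs.ne']
    ring
  · ring

end Asymptotics

/-! ### Boundaries of spaces of functions parametrised by a proper space -/

lemma tendsto_norm_ray {E : Type*} [NormedAddCommGroup E] [NormedSpace ℝ E] {n : E}
    (hn : ‖n‖ = 1) : Tendsto (fun y : E => ‖y‖) (map (fun r : ℝ => r • n) atTop) atTop := by
  rw [tendsto_map'_iff]
  simpa [Function.comp_def, norm_smul, hn] using tendsto_abs_atTop_atTop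

lemma tendsto_direction_ray {E : Type*} [NormedAddCommGroup E] [NormedSpace ℝ E] {n : E}
    (hn : ‖n‖ = 1) :
    Tendsto (fun y : E => ‖y‖⁻¹ • y) (map (fun r : ℝ => r • n) atTop) (𝓝 n) := by
  rw [tendsto_map'_iff]
  refine tendsto_const_nhds.congr' ?_
  filter_upwards [eventually_gt_atTop 0] with r hr
  rw [Function.comp_apply, norm_smul, hn, mul_one, Real.norm_of_nonneg hr.le, smul_smul,
    inv_mul_cancel₀ hr.ne', one_smul]

/-- If `K (·, y)` depends continuously on `y`, and converges to `H n` when `y` goes to infinity in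
the direction `n`, then the limit points of `{K (·, y)}` that are not themselves of this form are
the functions `H n`. -/
lemma closure_range_diff_range_eq {E : Type*} [NormedAddCommGroup E] [NormedSpace ℝ E]
    [ProperSpace E] {K H : E → E → ℝ} (hc : ∀ x, Continuous (K x))
    (hlim : ∀ n, ‖n‖ = 1 → ∀ l : Filter E, Tendsto (fun y => ‖y‖) l atTop →
      Tendsto (fun y => ‖y‖⁻¹ • y) l (𝓝 n) → ∀ x, Tendsto (K x) l (𝓝 (H n x)))
    (hne : ∀ n, ‖n‖ = 1 → ∀ y, (fun x => K x y) ≠ H n) :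
    closure (Set.range fun y x => K x y) \ (Set.range fun y x => K x y)
      = {h | ∃ n, ‖n‖ = 1 ∧ h = H n} := by
  ext h
  constructor
  · rintro ⟨hcl, hnot⟩
    have hnb : (comap (fun y x => K x y) (𝓝 h)).NeBot :=
      comap_neBot_iff_frequently.2 (mem_closure_iff_frequently.1 hcl)
    let u : Ultrafilter E := Ultrafilter.of (comap (fun y x => K x y) (𝓝 h))
    have hu : Tendsto (fun y x => K x y) u (𝓝 h) :=
      tendsto_comap.mono_left (Ultrafilter.of_le _)
    by_cases hb : ∃ B : ℝ, ∀ᶠ y in (u : Filter E), y ∈ Metric.closedBall (0 : E) B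
    · obtain ⟨B, hB⟩ := hb
      obtain ⟨y, -, hy⟩ := (isCompact_closedBall (0 : E) B).ultrafilter_le_nhds' u hB
      refine absurd ⟨y, ?_⟩ hnot
      exact tendsto_nhds_unique
        (((continuous_pi hc).tendsto y).mono_left hy) hu
    · rw [not_exists] at hb
      have hnorm : Tendsto (fun y : E => ‖y‖) u atTop := by
        refine tendsto_atTop.2 fun B => ?_
        filter_upwards [Ultrafilter.eventually_not.2 (hb B)] with y hy
        rw [mem_closedBall_zero_iff, not_le] at hy
        exact hy.le
      have hdir : ∀ᶠ y in (u : Filter E), ‖y‖⁻¹ • y ∈ Metric.sphere (0 : E) 1 := by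
        filter_upwards [hnorm.eventually_gt_atTop 0] with y hy
        rw [mem_sphere_zero_iff_norm, norm_smul, norm_inv, norm_norm, inv_mul_cancel₀ hy.ne']
      obtain ⟨n, hn, hun⟩ := (isCompact_sphere (0 : E) 1).ultrafilter_le_nhds'
        (u.map fun y => ‖y‖⁻¹ • y) hdir
      rw [mem_sphere_zero_iff_norm] at hn
      exact ⟨n, hn, tendsto_nhds_unique hu (tendsto_pi_nhds.2 (hlim n hn u hnorm hun))⟩
  · rintro ⟨n, hn, rfl⟩
    refine ⟨?_, fun ⟨y, hy⟩ => hne n hn y hy⟩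
    exact mem_closure_of_tendsto (tendsto_pi_nhds.2 (hlim n hn (map (· • n) atTop)
      (tendsto_norm_ray hn) (tendsto_direction_ray hn)))
      (Eventually.of_forall fun y => ⟨y, rfl⟩)

/-! ### The Martin boundary -/

section Boundary

variable {d : ℕ} {lam : ℝ}

lemma martinKernel_lq (hl : 0 ≤ lam) (x y : EuclideanSpace ℝ (Fin d)) :
    martinKernel (lqKernel d lam) 0 x y = ((lqStar lam x y - lqStar lam 0 y : ℝ) : EReal) := by
  rw [martinKernel, starKernel_lq hl, starKernel_lq hl, EReal.coe_sub]

lemma martinPoints_lq (hl : 0 ≤ lam) :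
    martinPoints (lqKernel d lam) 0
      = Set.range fun (y x : EuclideanSpace ℝ (Fin d)) => lqStar lam x y - lqStar lam 0 y := by
  ext g
  simp only [martinPoints, martinKernel_lq hl, EReal.coe_eq_coe_iff, Set.mem_ofPred_eq,
    Set.mem_range, funext_iff, eq_comm]

/-- The Martin boundary, from the limits `H n` of the Martin kernel in the directions `n`. A limit
that grows quadratically along a ray is not of the form `K (·, y)`, because `K (·, y)` is bounded
above: `A^* ≤ 0`. -/
lemma martinBoundary_lq (hl : 0 ≤ lam)
    {H : EuclideanSpace ℝ (Fin d) → EuclideanSpace ℝ (Fin d) → ℝ}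
    (hlim : ∀ n, ‖n‖ = 1 → ∀ l : Filter (EuclideanSpace ℝ (Fin d)),
      Tendsto (fun y => ‖y‖) l atTop → Tendsto (fun y => ‖y‖⁻¹ • y) l (𝓝 n) →
      ∀ x, Tendsto (fun y => lqStar lam x y - lqStar lam 0 y) l (𝓝 (H n x)))
    (hgrowth : ∀ n, ‖n‖ = 1 → ∀ t : ℝ, 0 < t → t ^ 2 ≤ H n (t • n)) :
    martinBoundary (lqKernel d lam) 0 = {h | ∃ n, ‖n‖ = 1 ∧ h = H n} := by
  rw [martinBoundary, martinSpace, martinPoints_lq hl]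
  refine closure_range_diff_range_eq
    (fun x => (continuous_lqStar hl x).sub (continuous_lqStar hl 0)) hlim fun n hn y hy => ?_
  have h1 := hgrowth n hn (1 - lqStar lam 0 y) (by linarith [lqStar_nonpos hl 0 y])
  rw [← hy] at h1
  nlinarith [lqStar_nonpos hl 0 y, lqStar_nonpos hl ((1 - lqStar lam 0 y) • n) y]

lemma tendsto_martinKernel_ray (hl : 0 ≤ lam) {n x : EuclideanSpace ℝ (Fin d)} {c : ℝ}
    (h : Tendsto (fun y => lqStar lam x y - lqStar lam 0 y) (map (fun r : ℝ => r • n) atTop)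
      (𝓝 c)) :
    Tendsto (fun r : ℝ => martinKernel (lqKernel d lam) 0 x (r • n)) atTop (𝓝 (c : EReal)) := by
  simp only [martinKernel_lq hl]
  exact (continuous_coe_real_ereal.tendsto c).comp (tendsto_map'_iff.1 h)

lemma horoZero_eq (n x : EuclideanSpace ℝ (Fin d)) :
    horoZero n x = (inner ℝ x n + |inner ℝ x n|) ^ 2 / 2 - ‖x‖ ^ 2 := by
  rw [horoZero]
  split_ifs with h
  · rw [abs_of_pos h]; ring
  · rw [abs_of_nonpos (not_lt.1 h)]; ring

lemma horoR_pos (hl : 0 < lam) (n x : EuclideanSpace ℝ (Fin d)) : 0 < horoR lam n x :=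
  sub_pos.2 (lt_sqrt_sq_add hl _)

lemma horoPos_eq (hl : 0 < lam) (n x : EuclideanSpace ℝ (Fin d)) :
    horoPos lam n x = (inner ℝ x n + √(inner ℝ x n ^ 2 + lam)) ^ 2 / 2 - lam / 2 - ‖x‖ ^ 2
        - lam * Real.log ((√(inner ℝ x n ^ 2 + lam) - inner ℝ x n) / √lam) := by
  have hR := horoR_pos hl n x
  have hs : √(inner ℝ x n ^ 2 + lam) ^ 2 = inner ℝ x n ^ 2 + lam :=
    Real.sq_sqrt (by positivity)
  have hsR : √(inner ℝ x n ^ 2 + lam) = horoR lam n x + inner ℝ x n := by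
    rw [horoR]; ring
  rw [horoPos, hsR, add_sub_cancel_right]
  rw [hsR] at hs
  have hlam : lam = horoR lam n x ^ 2 + 2 * horoR lam n x * inner ℝ x n := by
    linear_combination -hs
  congr 1
  generalize horoR lam n x = R at *
  rw [hlam]
  field_simp
  ring

lemma sq_le_horoZero {n : EuclideanSpace ℝ (Fin d)} (hn : ‖n‖ = 1) {t : ℝ} (ht : 0 < t) :
    t ^ 2 ≤ horoZero n (t • n) := by
  rw [horoZero_eq, real_inner_smul_left, real_inner_self_eq_norm_sq, norm_smul, hn,
    Real.norm_of_nonneg ht.le, one_pow, mul_one, abs_of_pos ht]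
  nlinarith

lemma sq_le_horoPos (hl : 0 < lam) {n : EuclideanSpace ℝ (Fin d)} (hn : ‖n‖ = 1) {t : ℝ}
    (ht : 0 < t) : t ^ 2 ≤ horoPos lam n (t • n) := by
  have hR := horoR_pos hl n (t • n)
  have hs0 : 0 < √lam := Real.sqrt_pos.2 hl
  have hss : √lam ^ 2 = lam := Real.sq_sqrt hl.le
  rw [horoPos_eq hl]
  rw [horoR] at hR
  rw [real_inner_smul_left, real_inner_self_eq_norm_sq, norm_smul, hn,
    Real.norm_of_nonneg ht.le, one_pow, mul_one] at *
  have hs : √(t ^ 2 + lam) ^ 2 = t ^ 2 + lam := Real.sq_sqrt (by positivity)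
  have hst : t ≤ √(t ^ 2 + lam) := by linarith
  have hle : √(t ^ 2 + lam) ≤ √lam + t :=
    Real.sqrt_le_iff.2 ⟨by positivity, by nlinarith [mul_pos hs0 ht]⟩
  have hlog : Real.log ((√(t ^ 2 + lam) - t) / √lam) ≤ 0 :=
    Real.log_nonpos (by positivity) (by rw [div_le_one hs0]; linarith)
  nlinarith [mul_nonneg hl.le (neg_nonneg.2 hlog)]

end Boundary

end LQMartin

end

open LQMartin in
theorem mainTheorem6 (d : ℕ) :
    -- the kernel of the normalised semigroup, for every horizon
    (∀ (lam T : ℝ) (x y : EuclideanSpace ℝ (Fin d)), 0 < T →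
      LQMartin.lqKernel d lam T x y =
        ((-(((‖x‖ ^ 2 + ‖y‖ ^ 2) * Real.cosh T - 2 * inner ℝ x y) / Real.sinh T)
          - lam * T : ℝ) : EReal)) ∧
    -- the kernel `A^*` is finite
    (∀ (lam : ℝ) (x y : EuclideanSpace ℝ (Fin d)), 0 ≤ lam →
      LQMartin.starKernel (LQMartin.lqKernel d lam) x y ≠ ⊥ ∧
        LQMartin.starKernel (LQMartin.lqKernel d lam) x y ≠ ⊤) ∧
    -- the case `lam = 0`: `A^*`
    (∀ x y : EuclideanSpace ℝ (Fin d), inner ℝ x y ≤ 0 →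
      LQMartin.starKernel (LQMartin.lqKernel d 0) x y =
        ((-‖x‖ ^ 2 - ‖y‖ ^ 2 : ℝ) : EReal)) ∧
    (∀ x y : EuclideanSpace ℝ (Fin d), 0 < inner ℝ x y →
      LQMartin.starKernel (LQMartin.lqKernel d 0) x y =
        ((-(‖x - y‖ * ‖x + y‖) : ℝ) : EReal)) ∧
    -- the case `lam = 0`: boundary points
    (∀ n : EuclideanSpace ℝ (Fin d), ‖n‖ = 1 → ∀ x : EuclideanSpace ℝ (Fin d),
      Filter.Tendsto (fun r : ℝ => LQMartin.martinKernel (LQMartin.lqKernel d 0) 0 x (r • n))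
        Filter.atTop (nhds (LQMartin.horoZero n x : EReal))) ∧
    LQMartin.martinBoundary (LQMartin.lqKernel d 0) 0 =
      {h | ∃ n : EuclideanSpace ℝ (Fin d), ‖n‖ = 1 ∧ h = LQMartin.horoZero n} ∧
    -- the case `lam > 0`
    (∀ lam : ℝ, 0 < lam →
      (∀ y : EuclideanSpace ℝ (Fin d),
        LQMartin.starKernel (LQMartin.lqKernel d lam) 0 y =
          ((-(‖y‖ * Real.sqrt (lam + ‖y‖ ^ 2))
            - lam * Real.log (Real.sqrt (lam + ‖y‖ ^ 2) + ‖y‖)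
            + lam * Real.log (Real.sqrt lam) : ℝ) : EReal)) ∧
      (∀ n : EuclideanSpace ℝ (Fin d), ‖n‖ = 1 → ∀ x : EuclideanSpace ℝ (Fin d),
        Filter.Tendsto (fun r : ℝ => LQMartin.martinKernel (LQMartin.lqKernel d lam) 0 x (r • n))
          Filter.atTop (nhds (LQMartin.horoPos lam n x : EReal))) ∧
      LQMartin.martinBoundary (LQMartin.lqKernel d lam) 0 =
        {h | ∃ n : EuclideanSpace ℝ (Fin d), ‖n‖ = 1 ∧ h = LQMartin.horoPos lam n}) := by
  have limZero : ∀ n : EuclideanSpace ℝ (Fin d), ‖n‖ = 1 → ∀ l : Filter _,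
      Tendsto (fun y => ‖y‖) l atTop → Tendsto (fun y => ‖y‖⁻¹ • y) l (𝓝 n) →
      ∀ x, Tendsto (fun y => lqStar 0 x y - lqStar 0 0 y) l (𝓝 (horoZero n x)) :=
    fun n _ l h1 h2 x => horoZero_eq n x ▸ tendsto_martin_zero h1 h2 x
  refine ⟨fun lam T x y hT => lqKernel_of_pos lam hT x y, fun lam x y hl => ?_,
    fun x y h => ?_, fun x y h => ?_, fun n hn x => ?_, ?_, fun lam hl => ?_⟩
  · rw [starKernel_lq hl]
    exact ⟨EReal.coe_ne_bot _, EReal.coe_ne_top _⟩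
  · rw [starKernel_lq le_rfl, lqStar_zero_of_nonpos h]
  · rw [starKernel_lq le_rfl, lqStar_zero_of_pos h]
  · exact tendsto_martinKernel_ray le_rfl
      (limZero n hn _ (tendsto_norm_ray hn) (tendsto_direction_ray hn) x)
  · exact martinBoundary_lq le_rfl limZero fun n hn t ht => sq_le_horoZero hn ht
  have limPos : ∀ n : EuclideanSpace ℝ (Fin d), ‖n‖ = 1 → ∀ l : Filter _,
      Tendsto (fun y => ‖y‖) l atTop → Tendsto (fun y => ‖y‖⁻¹ • y) l (𝓝 n) →
      ∀ x, Tendsto (fun y => lqStar lam x y - lqStar lam 0 y) l (𝓝 (horoPos lam n x)) :=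
    fun n _ l h1 h2 x => horoPos_eq hl n x ▸ tendsto_martin_pos hl h1 h2 x
  refine ⟨fun y => ?_, fun n hn x => ?_, ?_⟩
  · rw [starKernel_lq hl.le, lqStar_zero_left hl]
  · exact tendsto_martinKernel_ray hl.le
      (limPos n hn _ (tendsto_norm_ray hn) (tendsto_direction_ray hn) x)
  · exact martinBoundary_lq hl.le limPos fun n hn t ht => sq_le_horoPos hl hn ht
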